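/- Let $1\le k\le d$ be integers, $p\in[\tfrac12,1]$, $\varepsilon\in(0,1]$ and $\delta_0\in(0,1]$. Then there is a constant $\delta\in(0,1)$, depending only on $d,k,p,\varepsilon,\delta_0$, such that the following holds. Consider $n$ agents. Agent $i$ holds a local dataset of $q\ge1$ samples $\zeta_i^{(1)},\dots,\zeta_i^{(q)}\in Z_i$ and has a loss $l_i:\mathbb R^d\times Z_i\to\mathbb R$, differentiable in its first argument, with $|[\nabla l_i(x,\zeta)]_j|\le G/\sqrt d$ for all $x\in\mathbb R^d$, $\zeta\in Z_i$, $j\in\{1,\dots,d\}$. Let $\mathcal S$ be the Top-$k$ sparsifier, which keeps the $k$ coordinates of largest magnitude (ties broken in favour of the smaller index) and sets the others to $0$. The algorithm DO-ADP, with weights $w_{ij}\in\mathbb R$ and parameters $\alpha,\beta,\gamma\in\mathbb R$, starts from $x_{i,0}=x_0$, $\hat x_{i,0}=0$, $m_{i,0}=0$, and at iteration $t=0,\dots,T-1$ every agent $i$ draws $\eta_{i,t}\sim\mathrm{Bern}(p)$, a sample $\zeta_{i,t}$ uniform on its $q$ local samples, and $\theta_{i,t}\sim\mathcal N(0,\sigma^2I_d)$,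 all draws being independent, and sets $$m_{i,t+1}=\eta_{i,t}\big(\nabla l_i(x_{i,t},\zeta_{i,t})+\theta_{i,t}\big)+\beta m_{i,t},$$ $$x_{i,t+1}=x_{i,t}-\eta_{i,t}\,\alpha\, m_{i,t+1}+\gamma\sum_j w_{ij}(\hat x_{j,t}-\hat x_{i,t}),$$ $$s_{i,t}=\mathcal S(x_{i,t+1}-\hat x_{i,t}),\qquad \hat x_{i,t+1}=\hat x_{i,t}+\eta_{i,t}s_{i,t}.$$ Agent $i$ sends $s_{i,t}$ if $\eta_{i,t}=1$ and sends nothing if $\eta_{i,t}=0$. If $$\sigma^2\ \ge\ \frac{160\,k\,p^2\,T\log(1.25/\delta_0)\,G^2}{q^2\,d\,\varepsilon^2}\qquad\text{and}\qquad T\ \ge\ \frac{q^2\varepsilon^2}{4p^2},$$ then the algorithm is $(\varepsilon,\delta)$-differentially private during $T$ iterations: for any two collections of local datasets $\mathcal D,\mathcal D'$ that differ in at most one sample of one agent, and every measurable set $\mathcal O$ of possible values of the family $M$ of all messages exchanged during the $T$ iterations (including which agents were silent), $$\mathbb P\{M\in\mathcal O\mid\mathcal D\}\ \le\ e^{\varepsilon}\,\mathbb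 P\{M\in\mathcal O\mid\mathcal D'\}+\delta .$$ -/

import Mathlib

open MeasureTheory ProbabilityTheory

noncomputable section

namespace DOADP

/-- Coordinate `j` of `x` is kept by the top-`k` sparsifier: fewer than `k` coordinates come before
it in the ordering by decreasing magnitude (ties are broken in favour of the smaller index). -/
def Kept {d : ℕ} (k : ℕ) (x : EuclideanSpace ℝ (Fin d)) (j : Fin d) : Prop :=
  {l : Fin d | |x j| < |x l| ∨ (|x l| = |x j| ∧ l < j)}.ncard < k

open Classical in
/-- Top-`k` sparsification: keep the `k` coordinates of largest magnitude, set the others to `0`. -/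
def topK {d : ℕ} (k : ℕ) (x : EuclideanSpace ℝ (Fin d)) : EuclideanSpace ℝ (Fin d) :=
  WithLp.toLp 2 fun j => if Kept k x j then x j else 0

/-- The public data of the algorithm for `n` agents with states in `ℝ^d`, and the loss functions
`l_i : ℝ^d × Z_i → ℝ`, where `Z_i` is the set of admissible data samples of agent `i`. -/
structure Setup (n d : ℕ) (Z : Fin n → Type*) where
  /-- weight matrix of the communication network -/
  W : Matrix (Fin n) (Fin n) ℝ
  /-- stochastic gradient step size -/
  α : ℝ
  /-- momentum factor -/
  β : ℝ
  /-- consensus step size -/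
  γ : ℝ
  /-- common initial state of the agents -/
  x₀ : EuclideanSpace ℝ (Fin d)
  /-- loss functions -/
  loss : ∀ i, EuclideanSpace ℝ (Fin d) → Z i → ℝ

/-- The local datasets: agent `i` holds the `q` samples `D i 0, …, D i (q - 1)`. -/
abbrev Dataset {n : ℕ} (q : ℕ) (Z : Fin n → Type*) := ∀ i, Fin q → Z i

/-- Two collections of local datasets are neighbouring if they agree except possibly for
one sample of one agent. -/
def Neighboring {n q : ℕ} {Z : Fin n → Type*} (D D' : Dataset q Z) : Prop :=
  ∃ (i₀ : Fin n) (j₀ : Fin q), ∀ i j, ¬ (i = i₀ ∧ j = j₀) → D i j = D' i j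

/-- The variables of all agents: the private states `x_i`, their public copies `x̂_i`, and
the momenta `m_i`. -/
structure State (n d : ℕ) where
  x : Fin n → EuclideanSpace ℝ (Fin d)
  xhat : Fin n → EuclideanSpace ℝ (Fin d)
  m : Fin n → EuclideanSpace ℝ (Fin d)

/-- The random draws of one agent in one iteration: the activation `η`, the index of the local
sample, and the coordinates of the noise `θ`. -/
abbrev Draw (d q : ℕ) := Bool × Fin q × (Fin d → ℝ)

/-- The law of the draws of one agent in one iteration: `η ~ Bern(p)`, the index is uniform
on the `q` samples, `θ ~ N(0, σ² I_d)`, and the three are independent. -/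
def drawLaw (d q : ℕ) (p σ : ℝ) : Measure (Draw d q) :=
  (ENNReal.ofReal p • Measure.dirac true + ENNReal.ofReal (1 - p) • Measure.dirac false).prod
    ((uniformOn (Set.univ : Set (Fin q))).prod
      (Measure.pi fun _ : Fin d => gaussianReal 0 (σ ^ 2).toNNReal))

/-- The draws of all agents in `T` iterations are independent. -/
def noiseLaw (n d q T : ℕ) (p σ : ℝ) : Measure (Fin T → Fin n → Draw d q) :=
  Measure.pi fun _ => Measure.pi fun _ => drawLaw d q p σ

namespace Setup

variable {n d q : ℕ} {Z : Fin n → Type*}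

/-- Initial values of the variables. -/
def init (A : Setup n d Z) : State n d where
  x := fun _ => A.x₀
  xhat := fun _ => 0
  m := fun _ => 0

/-- The stochastic gradient of agent `i` at its current state. -/
def grad (A : Setup n d Z) (D : Dataset q Z) (S : State n d) (r : Fin n → Draw d q) (i : Fin n) :
    EuclideanSpace ℝ (Fin d) :=
  gradient (fun y => A.loss i y (D i (r i).2.1)) (S.x i)

/-- The new momentum of agent `i`. -/
def newM (A : Setup n d Z) (D : Dataset q Z) (S : State n d) (r : Fin n → Draw d q) (i : Fin n) :
    EuclideanSpace ℝ (Fin d) :=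
  if (r i).1 = true then A.grad D S r i + WithLp.toLp 2 (r i).2.2 + A.β • S.m i else A.β • S.m i

/-- The new private state of agent `i`. -/
def newX (A : Setup n d Z) (D : Dataset q Z) (S : State n d) (r : Fin n → Draw d q) (i : Fin n) :
    EuclideanSpace ℝ (Fin d) :=
  if (r i).1 = true then
    S.x i - A.α • A.newM D S r i + A.γ • ∑ j, A.W i j • (S.xhat j - S.xhat i)
  else S.x i + A.γ • ∑ j, A.W i j • (S.xhat j - S.xhat i)

/-- What agent `i` sends in one iteration: `(true, s_i)` if it is active, and nothing,
encoded as `(false, 0)`, if it is not. -/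
def message (A : Setup n d Z) (k : ℕ) (D : Dataset q Z) (S : State n d) (r : Fin n → Draw d q)
    (i : Fin n) : Bool × EuclideanSpace ℝ (Fin d) :=
  if (r i).1 = true then (true, topK k (A.newX D S r i - S.xhat i)) else (false, 0)

/-- One iteration of the algorithm. -/
def step (A : Setup n d Z) (k : ℕ) (D : Dataset q Z) (S : State n d) (r : Fin n → Draw d q) :
    State n d where
  x := A.newX D S r
  xhat := fun i => S.xhat i + (A.message k D S r i).2
  m := A.newM D S r

/-- The variables after `t` iterations. -/
def state (A : Setup n d Z) (k : ℕ) (D : Dataset q Z) {T : ℕ} (ω : Fin T → Fin n → Draw d q) :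
    (t : ℕ) → t ≤ T → State n d
  | 0, _ => A.init
  | t + 1, h => A.step k D (A.state k D ω t (Nat.le_of_succ_le h)) (ω ⟨t, h⟩)

/-- All the messages exchanged in `T` iterations. -/
def transcript (A : Setup n d Z) (k : ℕ) (D : Dataset q Z) {T : ℕ}
    (ω : Fin T → Fin n → Draw d q) : Fin T → Fin n → Bool × EuclideanSpace ℝ (Fin d) :=
  fun t i => A.message k D (A.state k D ω t t.2.le) (ω t) i

/-- `(ε, δ)`-differential privacy of the algorithm during `T` iterations. -/
def IsDP (A : Setup n d Z) (k q T : ℕ) (p σ ε δ : ℝ) : Prop :=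
  ∀ D D' : Dataset q Z, Neighboring D D' →
    ∀ O : Set (Fin T → Fin n → Bool × EuclideanSpace ℝ (Fin d)), MeasurableSet O →
      noiseLaw n d q T p σ {ω | A.transcript k D ω ∈ O} ≤
        ENNReal.ofReal (Real.exp ε) * noiseLaw n d q T p σ {ω | A.transcript k D' ω ∈ O}
          + ENNReal.ofReal δ

/-- Every stochastic gradient exists and has coordinates bounded by `G / √d`. -/
def BoundedGradients (A : Setup n d Z) (G : ℝ) : Prop :=
  ∀ (i : Fin n) (ζ : Z i), Differentiable ℝ (fun y => A.loss i y ζ) ∧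
    ∀ (x : EuclideanSpace ℝ (Fin d)) (j : Fin d),
      |gradient (fun y => A.loss i y ζ) x j| ≤ G / √(d : ℝ)

end Setup

end DOADP

end

open MeasureTheory ProbabilityTheory
open scoped NNReal ENNReal

namespace DOADP

/-! The messages are post-processing of noisy stochastic gradients, so neither sparsification nor
momentum nor consensus matters for privacy. It suffices to control the joint law of all activations
and noisy gradients, one iteration at a time, from an arbitrary current state.

Given the state, only one agent's law depends on which neighbouring dataset is used. Its noisy
gradient follows a uniform mixture of `q` Gaussians, and one component moves by at most `2G`. With
`M = 4G²/σ²`, a χ²-type computation gives `(E_μ f)² ≤ (1 + s) E_ν f²` for `[0,1]`-valued `f`, where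
`s = 4(exp M - 1)/q²` (`sq_integral_gaussian_mixture_le`). The factor `1/q²`, rather than `1/q`, is
essential: it comes from comparing the moved component with every component of the reference mixture
and averaging.

This inequality (`Dominated`) is stable under maps and multiplies under adaptive composition
(`Dominated.map_prod`), so the whole run has constant `(1 + s)^T ≤ exp(sT)`. The noise condition
bounds `T M / q²`, and the lower bound on `T` then bounds `M` itself; together they give `sT ≤ C`
with `C` depending only on `d, k, p, ε, δ₀`. Finally `P² ≤ exp(C) Q` for the probabilities of an
event forces `P ≤ Q + δ` with `δ = 1 - 1/(4 exp C) < 1` (`Dominated.measure_le_add`). The factor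
`exp ε` enters only through `exp ε ≥ 1`. -/

/-! ### Translates of Gaussian measures and their densities -/

/-- The density of the translate by `a` of a product of centred Gaussian measures of variance `v`
with respect to the untranslated measure. -/
noncomputable def shiftDensity {d : ℕ} (v : ℝ≥0) (a θ : Fin d → ℝ) : ℝ :=
  ∏ j, Real.exp (a j * θ j / v - a j ^ 2 / (2 * v))

theorem gaussianReal_eq_withDensity {v : ℝ≥0} (hv : v ≠ 0) (a : ℝ) :
    gaussianReal a v = (gaussianReal 0 v).withDensity
      (fun x => ENNReal.ofReal (Real.exp (a * x / v - a ^ 2 / (2 * v)))) := by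
  rw [gaussianReal_of_var_ne_zero _ hv, gaussianReal_of_var_ne_zero _ hv,
    ← withDensity_mul _ (measurable_gaussianPDF 0 v) (by fun_prop)]
  congr 1
  ext x
  have hv' : (v : ℝ) ≠ 0 := by exact_mod_cast hv
  simp only [gaussianPDF, Pi.mul_apply]
  rw [← ENNReal.ofReal_mul (gaussianPDFReal_nonneg _ _ _)]
  congr 1
  simp only [gaussianPDFReal, mul_assoc, ← Real.exp_add]
  congr 3
  field_simp
  ring

theorem integrable_exp_affine (v : ℝ≥0) (b c : ℝ) :
    Integrable (fun x => Real.exp (b * x - c)) (gaussianReal 0 v) := by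
  simp only [Real.exp_sub]
  exact (integrable_exp_mul_gaussianReal b).div_const _

theorem integral_exp_affine (v : ℝ≥0) (b c : ℝ) :
    ∫ x, Real.exp (b * x - c) ∂gaussianReal 0 v = Real.exp (v * b ^ 2 / 2 - c) := by
  simp only [Real.exp_sub, integral_div]
  have h := congrFun (mgf_fun_id_gaussianReal (μ := 0) (v := v)) b
  simp only [mgf, zero_mul, zero_add] at h
  rw [h]

section

variable {d : ℕ} {v : ℝ≥0}

theorem shiftDensity_nonneg (a θ : Fin d → ℝ) : 0 ≤ shiftDensity v a θ :=
  Finset.prod_nonneg fun _ _ => (Real.exp_pos _).le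

@[fun_prop]
theorem measurable_shiftDensity (a : Fin d → ℝ) : Measurable (shiftDensity v a) := by
  unfold shiftDensity
  fun_prop

/-- Cameron–Martin in finite dimension. Both measures are compared on boxes, where the density
factors and the one-dimensional formula applies. -/
theorem map_add_pi_gaussianReal (hv : v ≠ 0) (a : Fin d → ℝ) :
    (Measure.pi fun _ : Fin d => gaussianReal 0 v).map (fun θ => a + θ) =
      (Measure.pi fun _ : Fin d => gaussianReal 0 v).withDensity
        (fun θ => ENNReal.ofReal (shiftDensity v a θ)) := by
  have h1 : (Measure.pi fun _ : Fin d => gaussianReal 0 v).map (fun θ => a + θ) =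
      Measure.pi fun j => gaussianReal (a j) v := by
    have := Measure.pi_map_pi (μ := fun _ : Fin d => gaussianReal 0 v)
      (f := fun j x => a j + x) (fun j => by fun_prop)
    simp only [gaussianReal_map_const_add, zero_add] at this
    exact this
  rw [h1]
  refine Measure.pi_eq fun s hs => ?_
  simp only [shiftDensity]
  have hint : ∀ j, Integrable (fun x => Real.exp (a j * x / v - a j ^ 2 / (2 * v)))
      ((gaussianReal 0 v).restrict (s j)) := fun j => by
    have := integrable_exp_affine v (a j / v) (a j ^ 2 / (2 * v))
    simp only [div_mul_eq_mul_div] at this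
    exact this.restrict
  rw [withDensity_apply _ (MeasurableSet.univ_pi hs), Measure.restrict_pi_pi,
    ← ofReal_integral_eq_lintegral_ofReal
      (Integrable.fintype_prod_dep (f := fun j x => Real.exp (a j * x / v - a j ^ 2 / (2 * v))) hint)
      (Filter.Eventually.of_forall fun θ => shiftDensity_nonneg a θ)]
  rw [integral_fintype_prod_eq_prod
    (f := fun j x => Real.exp (a j * x / v - a j ^ 2 / (2 * v))),
    ENNReal.ofReal_prod_of_nonneg fun j _ => integral_nonneg fun x => (Real.exp_pos _).le]
  refine Finset.prod_congr rfl fun j _ => ?_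
  rw [gaussianReal_eq_withDensity hv (a j), withDensity_apply _ (hs j),
    ofReal_integral_eq_lintegral_ofReal (hint j)
      (Filter.Eventually.of_forall fun x => (Real.exp_pos _).le)]

theorem integral_add_eq_integral_shiftDensity_mul (hv : v ≠ 0) (a : Fin d → ℝ)
    {ψ : (Fin d → ℝ) → ℝ} (hψ : Measurable ψ) :
    ∫ θ, ψ (a + θ) ∂(Measure.pi fun _ : Fin d => gaussianReal 0 v) =
      ∫ θ, shiftDensity v a θ * ψ θ ∂(Measure.pi fun _ : Fin d => gaussianReal 0 v) := by
  rw [← integral_map (φ := fun θ => a + θ) (f := ψ) (by fun_prop) hψ.aestronglyMeasurable,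
    map_add_pi_gaussianReal hv a,
    integral_withDensity_eq_integral_toReal_smul (by fun_prop)
      (Filter.Eventually.of_forall fun _ => ENNReal.ofReal_lt_top)]
  simp only [ENNReal.toReal_ofReal (shiftDensity_nonneg a _), smul_eq_mul]

theorem shiftDensity_mul_shiftDensity (a b θ : Fin d → ℝ) :
    shiftDensity v a θ * shiftDensity v b θ =
      ∏ j, Real.exp ((a j + b j) / v * θ j - (a j ^ 2 + b j ^ 2) / (2 * v)) := by
  unfold shiftDensity
  rw [← Finset.prod_mul_distrib]
  refine Finset.prod_congr rfl fun j _ => ?_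
  rw [← Real.exp_add]
  congr 1
  ring

theorem integrable_shiftDensity_mul (a b : Fin d → ℝ) :
    Integrable (fun θ => shiftDensity v a θ * shiftDensity v b θ)
      (Measure.pi fun _ : Fin d => gaussianReal 0 v) := by
  simp only [shiftDensity_mul_shiftDensity]
  exact Integrable.fintype_prod_dep
    (f := fun j x => Real.exp ((a j + b j) / v * x - (a j ^ 2 + b j ^ 2) / (2 * v)))
    fun j => integrable_exp_affine v _ _

/-- In each coordinate the Gaussian moment generating function leaves `(a + b)²/(2v) - (a² +
b²)/(2v) = ab/v`. -/
theorem integral_shiftDensity_mul (hv : v ≠ 0) (a b : Fin d → ℝ) :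
    ∫ θ, shiftDensity v a θ * shiftDensity v b θ
      ∂(Measure.pi fun _ : Fin d => gaussianReal 0 v) = Real.exp ((∑ j, a j * b j) / v) := by
  have hv' : (v : ℝ) ≠ 0 := by exact_mod_cast hv
  simp only [shiftDensity_mul_shiftDensity]
  rw [integral_fintype_prod_eq_prod
    (f := fun j x => Real.exp ((a j + b j) / v * x - (a j ^ 2 + b j ^ 2) / (2 * v))),
    Finset.sum_div, Real.exp_sum]
  refine Finset.prod_congr rfl fun j _ => ?_
  rw [integral_exp_affine]
  congr 1
  field_simp
  ring

end

/-! ### χ²-type bounds for translates and mixtures -/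

theorem sq_integral_mul_le {α : Type*} [MeasurableSpace α] {μ : Measure α} {f g : α → ℝ}
    (hf : Integrable (fun x => f x ^ 2) μ) (hg : Integrable (fun x => g x ^ 2) μ)
    (hfg : Integrable (fun x => f x * g x) μ) :
    (∫ x, f x * g x ∂μ) ^ 2 ≤ (∫ x, f x ^ 2 ∂μ) * ∫ x, g x ^ 2 ∂μ := by
  have h : ∀ t : ℝ, 0 ≤ (∫ x, g x ^ 2 ∂μ) * (t * t) + (2 * ∫ x, f x * g x ∂μ) * t +
      ∫ x, f x ^ 2 ∂μ := fun t => by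
    have h0 : 0 ≤ ∫ x, (f x + t * g x) ^ 2 ∂μ := integral_nonneg fun x => sq_nonneg _
    have h1 : ∫ x, (f x + t * g x) ^ 2 ∂μ =
        ∫ x, (f x ^ 2 + (2 * t) * (f x * g x)) + t ^ 2 * g x ^ 2 ∂μ := by
      congr 1; ext x; ring
    have h2 : Integrable (fun x => f x ^ 2 + (2 * t) * (f x * g x)) μ := hf.add (hfg.const_mul _)
    rw [h1, integral_add h2 (hg.const_mul _),
      integral_add hf (hfg.const_mul _), integral_const_mul, integral_const_mul] at h0
    linarith
  have := discrim_le_zero h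
  rw [discrim] at this
  linarith

section

variable {d : ℕ} {v : ℝ≥0}

theorem integrable_of_bounded {α : Type*} [MeasurableSpace α] {μ : Measure α} [IsFiniteMeasure μ]
    {ψ : α → ℝ} (hψ : Measurable ψ) {B : ℝ} (hB : ∀ x, |ψ x| ≤ B) : Integrable ψ μ :=
  Integrable.of_bound hψ.aestronglyMeasurable B (Filter.Eventually.of_forall fun x => by
    simpa using hB x)

/-- Cauchy–Schwarz in L² of the centred Gaussian, applied to the difference of the two shift
densities times `ψ`. The exponential factor is the exact squared norm of that difference. -/
theorem sq_integral_add_sub_integral_add_le_exp (hv : v ≠ 0) (a b : Fin d → ℝ)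
    {ψ : (Fin d → ℝ) → ℝ} (hψ : Measurable ψ) {B : ℝ} (hB : ∀ x, |ψ x| ≤ B) :
    (∫ θ, ψ (a + θ) ∂(Measure.pi fun _ : Fin d => gaussianReal 0 v) -
      ∫ θ, ψ (b + θ) ∂(Measure.pi fun _ : Fin d => gaussianReal 0 v)) ^ 2 ≤
    (Real.exp ((∑ j, a j * a j) / v) + Real.exp ((∑ j, b j * b j) / v) -
      2 * Real.exp ((∑ j, a j * b j) / v)) *
      ∫ θ, ψ θ ^ 2 ∂(Measure.pi fun _ : Fin d => gaussianReal 0 v) := by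
  set γ := Measure.pi fun _ : Fin d => gaussianReal 0 v with hγ
  have hexpand : ∀ θ, (shiftDensity v a θ - shiftDensity v b θ) ^ 2 =
      (shiftDensity v a θ * shiftDensity v a θ + shiftDensity v b θ * shiftDensity v b θ) -
        2 * (shiftDensity v a θ * shiftDensity v b θ) := fun θ => by ring
  have hsum : Integrable (fun θ => shiftDensity v a θ * shiftDensity v a θ +
      shiftDensity v b θ * shiftDensity v b θ) γ :=
    (integrable_shiftDensity_mul a a).add (integrable_shiftDensity_mul b b)
  have hsq : Integrable (fun θ => (shiftDensity v a θ - shiftDensity v b θ) ^ 2) γ := by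
    simp only [hexpand]
    exact hsum.sub ((integrable_shiftDensity_mul a b).const_mul 2)
  have hint : ∀ c : Fin d → ℝ, Integrable (shiftDensity v c) γ := fun c => by
    -- The zero shift has density `1`, so integrability of a single density is a case of that of a
    -- product.
    have := integrable_shiftDensity_mul (v := v) c 0
    have h0 : ∀ θ, shiftDensity v (0 : Fin d → ℝ) θ = 1 := fun θ => by simp [shiftDensity]
    simpa only [h0, mul_one] using this
  have hintψ : ∀ c : Fin d → ℝ, Integrable (fun θ => shiftDensity v c θ * ψ θ) γ := fun c =>
    (hint c).mul_bdd (c := B) hψ.aestronglyMeasurable (Filter.Eventually.of_forall fun x => by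
      simpa using hB x)
  have hψ2 : Integrable (fun θ => ψ θ ^ 2) γ :=
    integrable_of_bounded (hψ.pow_const 2) (B := B ^ 2) fun x => by
      rw [abs_pow]; exact pow_le_pow_left₀ (abs_nonneg _) (hB x) 2
  have hprod : Integrable (fun θ => (shiftDensity v a θ - shiftDensity v b θ) * ψ θ) γ := by
    simp only [sub_mul]
    exact (hintψ a).sub (hintψ b)
  have hnorm : ∫ θ, (shiftDensity v a θ - shiftDensity v b θ) ^ 2 ∂γ =
      Real.exp ((∑ j, a j * a j) / v) + Real.exp ((∑ j, b j * b j) / v) -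
      2 * Real.exp ((∑ j, a j * b j) / v) := by
    simp only [hexpand]
    rw [integral_sub hsum ((integrable_shiftDensity_mul a b).const_mul 2),
      integral_add (integrable_shiftDensity_mul a a) (integrable_shiftDensity_mul b b),
      integral_const_mul, integral_shiftDensity_mul hv, integral_shiftDensity_mul hv,
      integral_shiftDensity_mul hv]
  rw [integral_add_eq_integral_shiftDensity_mul hv a hψ,
    integral_add_eq_integral_shiftDensity_mul hv b hψ, ← integral_sub (hintψ a) (hintψ b), ← hnorm]
  simp only [← sub_mul]
  exact sq_integral_mul_le hsq hψ2 hprod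

/-- Recentring at `c` reduces to the previous bound. Since `⟨u, w⟩ ≥ -(|u|² + |w|²)/2`, the
exponential factor is at most `2 exp M - 2 exp(-M)`, and `exp M + exp(-M) ≥ 2` turns this into
`4(exp M - 1)`. The centre `c` is free so that every mixture component can serve as reference. -/
theorem sq_integral_add_sub_integral_add_le (hv : v ≠ 0) {a b c : Fin d → ℝ} {M : ℝ}
    (ha : ∑ j, (a j - c j) ^ 2 ≤ M * v) (hb : ∑ j, (b j - c j) ^ 2 ≤ M * v)
    {ψ : (Fin d → ℝ) → ℝ} (hψ : Measurable ψ) {B : ℝ} (hB : ∀ x, |ψ x| ≤ B) :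
    (∫ θ, ψ (a + θ) ∂(Measure.pi fun _ : Fin d => gaussianReal 0 v) -
      ∫ θ, ψ (b + θ) ∂(Measure.pi fun _ : Fin d => gaussianReal 0 v)) ^ 2 ≤
    4 * (Real.exp M - 1) *
      ∫ θ, ψ (c + θ) ^ 2 ∂(Measure.pi fun _ : Fin d => gaussianReal 0 v) := by
  have hv' : (0 : ℝ) < v := by exact_mod_cast pos_iff_ne_zero.mpr hv
  have h := sq_integral_add_sub_integral_add_le_exp hv (a - c) (b - c) (ψ := fun x => ψ (c + x))
    (by fun_prop) (fun x => hB _)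
  simp only [← add_assoc, add_sub_cancel, Pi.sub_apply] at h
  refine h.trans (mul_le_mul_of_nonneg_right ?_ (integral_nonneg fun _ => sq_nonneg _))
  have h1 : Real.exp ((∑ j, (a j - c j) * (a j - c j)) / v) ≤ Real.exp M := by
    rw [Real.exp_le_exp, div_le_iff₀ hv']; simpa only [sq] using ha
  have h2 : Real.exp ((∑ j, (b j - c j) * (b j - c j)) / v) ≤ Real.exp M := by
    rw [Real.exp_le_exp, div_le_iff₀ hv']; simpa only [sq] using hb
  have h3 : Real.exp (-M) ≤ Real.exp ((∑ j, (a j - c j) * (b j - c j)) / v) := by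
    rw [Real.exp_le_exp, le_div_iff₀ hv']
    have : 0 ≤ ∑ j, ((a j - c j) + (b j - c j)) ^ 2 := Finset.sum_nonneg fun _ _ => sq_nonneg _
    have e : ∑ j, ((a j - c j) + (b j - c j)) ^ 2 = ∑ j, (a j - c j) ^ 2 + ∑ j, (b j - c j) ^ 2 +
        2 * ∑ j, (a j - c j) * (b j - c j) := by
      rw [Finset.mul_sum, ← Finset.sum_add_distrib, ← Finset.sum_add_distrib]
      exact Finset.sum_congr rfl fun _ _ => by ring
    linarith
  have h4 : 2 ≤ Real.exp M + Real.exp (-M) := by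
    have := Real.one_le_cosh M
    rw [Real.cosh_eq] at this
    linarith
  linarith

/-- By AM-GM the cross term satisfies `2xy ≤ s x² + V`; adding `y² ≤ sV` makes the product factor.
-/
theorem add_sq_le_of_sq_le {x y s V : ℝ} (hs : 0 ≤ s) (hV : 0 ≤ V) (h : y ^ 2 ≤ s * V) :
    (x + y) ^ 2 ≤ (1 + s) * (x ^ 2 + V) := by
  have h1 : (2 * (x * y)) ^ 2 ≤ (s * x ^ 2 + V) ^ 2 := by
    nlinarith [sq_nonneg (s * x ^ 2 - V), mul_le_mul_of_nonneg_left h (sq_nonneg x)]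
  have h2 := abs_le_of_sq_le_sq h1 (by positivity)
  nlinarith [le_abs_self (2 * (x * y))]

/-- Mixtures of `q` translated Gaussians which differ in at most one component. -/
theorem sq_integral_gaussian_mixture_le (hv : v ≠ 0) {q : ℕ} [NeZero q]
    {a a' : Fin q → Fin d → ℝ} (j₀ : Fin q) (haa : ∀ j, j ≠ j₀ → a j = a' j) {M : ℝ}
    (ha : ∀ j, ∑ l, (a j₀ l - a' j l) ^ 2 ≤ M * v) (ha' : ∀ j, ∑ l, (a' j₀ l - a' j l) ^ 2 ≤ M * v)
    {ψ : (Fin d → ℝ) → ℝ} (hψ : Measurable ψ) (hB : ∀ x, |ψ x| ≤ 1) :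
    ((∑ j, ∫ θ, ψ (a j + θ) ∂(Measure.pi fun _ : Fin d => gaussianReal 0 v)) / q) ^ 2 ≤
    (1 + 4 * (Real.exp M - 1) / q ^ 2) *
      ((∑ j, ∫ θ, ψ (a' j + θ) ^ 2 ∂(Measure.pi fun _ : Fin d => gaussianReal 0 v)) / q) := by
  set γ := Measure.pi fun _ : Fin d => gaussianReal 0 v with hγ
  have hq : (0 : ℝ) < q := by exact_mod_cast Nat.pos_of_neZero q
  have hv' : (0 : ℝ) < v := by exact_mod_cast pos_iff_ne_zero.mpr hv
  have hM : 0 ≤ M := by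
    have := (Finset.sum_nonneg fun l _ => sq_nonneg (a' j₀ l - a' j₀ l)).trans (ha' j₀)
    exact nonneg_of_mul_nonneg_left this hv'
  have hint : ∀ c : Fin d → ℝ, Integrable (fun θ => ψ (c + θ)) γ := fun c =>
    integrable_of_bounded (by fun_prop) (B := 1) fun x => hB _
  have hint2 : ∀ c : Fin d → ℝ, Integrable (fun θ => ψ (c + θ) ^ 2) γ := fun c =>
    integrable_of_bounded (by fun_prop) (B := 1) fun x => by
      rw [abs_pow]; exact pow_le_one₀ (abs_nonneg _) (hB _)
  set x := (∑ j, ∫ θ, ψ (a' j + θ) ∂γ) / q with hx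
  set E2 := (∑ j, ∫ θ, ψ (a' j + θ) ^ 2 ∂γ) / q with hE2
  -- The two mixture means differ only through component `j₀`, of weight `1/q`.
  set y := (∫ θ, ψ (a j₀ + θ) ∂γ - ∫ θ, ψ (a' j₀ + θ) ∂γ) / q with hy
  have hxy : (∑ j, ∫ θ, ψ (a j + θ) ∂γ) / q = x + y := by
    rw [hx, hy, ← add_div]
    congr 1
    rw [← sub_eq_iff_eq_add', ← Finset.sum_sub_distrib, Finset.sum_eq_single j₀]
    · intro j _ hj; rw [haa j hj, sub_self]
    · simp
  have hvar : ∀ j, ∫ θ, (ψ (a' j + θ) - x) ^ 2 ∂γ =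
      ∫ θ, ψ (a' j + θ) ^ 2 ∂γ - 2 * x * ∫ θ, ψ (a' j + θ) ∂γ + x ^ 2 := fun j => by
    have : ∀ θ, (ψ (a' j + θ) - x) ^ 2 = ψ (a' j + θ) ^ 2 - 2 * x * ψ (a' j + θ) + x ^ 2 :=
      fun θ => by ring
    simp only [this]
    have hsub : Integrable (fun θ => ψ (a' j + θ) ^ 2 - 2 * x * ψ (a' j + θ)) γ :=
      (hint2 _).sub ((hint _).const_mul _)
    rw [integral_add hsub (integrable_const _),
      integral_sub (hint2 _) ((hint _).const_mul _), integral_const_mul]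
    simp
  have hsumvar : (∑ j, ∫ θ, (ψ (a' j + θ) - x) ^ 2 ∂γ) / q = E2 - x ^ 2 := by
    simp only [hvar, Finset.sum_add_distrib, Finset.sum_sub_distrib, ← Finset.mul_sum]
    simp only [Finset.sum_const, Finset.card_univ, Fintype.card_fin, nsmul_eq_mul]
    rw [add_div, sub_div, mul_div_assoc, ← hx, mul_div_cancel_left₀ _ hq.ne']
    rw [hE2]; ring
  have hV : 0 ≤ E2 - x ^ 2 := by
    rw [← hsumvar]
    exact div_nonneg (Finset.sum_nonneg fun j _ => integral_nonneg fun _ => sq_nonneg _) hq.le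
  -- Subtracting the constant `x` from `ψ` leaves `y` unchanged, and any `a' j` may be the reference
  -- centre. Averaging over `j` then yields the variance `E2 - x²` of `ψ` under the second mixture.
  have hyj : ∀ j, y ^ 2 ≤ 4 * (Real.exp M - 1) / q ^ 2 * ∫ θ, (ψ (a' j + θ) - x) ^ 2 ∂γ := by
    intro j
    have h := sq_integral_add_sub_integral_add_le hv (ha j) (ha' j) (ψ := fun z => ψ z - x)
      (by fun_prop) (B := 1 + |x|) (fun z => (abs_sub _ _).trans (by gcongr; exact hB z))
    rw [integral_sub (hint _) (integrable_const _), integral_sub (hint _) (integrable_const _),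
      sub_sub_sub_cancel_right] at h
    rw [hy, div_pow, div_mul_eq_mul_div]
    gcongr
  have hy2 : y ^ 2 ≤ 4 * (Real.exp M - 1) / q ^ 2 * (E2 - x ^ 2) := by
    rw [← hsumvar, ← mul_div_assoc, le_div_iff₀ hq, Finset.mul_sum]
    calc y ^ 2 * q = ∑ _j : Fin q, y ^ 2 := by simp [mul_comm]
      _ ≤ _ := Finset.sum_le_sum fun j _ => hyj j
  have hs : 0 ≤ 4 * (Real.exp M - 1) / (q : ℝ) ^ 2 := by
    have := Real.one_le_exp hM
    have : 0 ≤ Real.exp M - 1 := by linarith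
    positivity
  rw [hxy]
  have := add_sq_le_of_sq_le (x := x) hs hV hy2
  simpa using this

end


/-! ### Domination and its composition rules -/

/-- Expectations of `[0, 1]`-valued functions under `μ` are controlled by their second moments
under `ν`. For probability measures this is a bound on the `χ²`-divergence that is stable under
adaptive composition. -/
def Dominated {α : Type*} [MeasurableSpace α] (K : ℝ≥0∞) (μ ν : Measure α) : Prop :=
  ∀ f : α → ℝ≥0∞, Measurable f → (∀ x, f x ≤ 1) → (∫⁻ x, f x ∂μ) ^ 2 ≤ K * ∫⁻ x, f x ^ 2 ∂ν

namespace Dominated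

variable {α β γ : Type*} [MeasurableSpace α] [MeasurableSpace β] [MeasurableSpace γ]

theorem refl {K : ℝ≥0∞} (hK : 1 ≤ K) (μ : Measure α) [IsProbabilityMeasure μ] :
    Dominated K μ μ := by
  intro f hf _
  have h := ENNReal.lintegral_mul_le_Lp_mul_Lq μ Real.HolderConjugate.two_two
    hf.aemeasurable (aemeasurable_const (b := (1 : ℝ≥0∞)))
  simp only [Pi.mul_apply, mul_one, ENNReal.rpow_ofNat, one_pow, lintegral_const, measure_univ,
    ENNReal.one_rpow] at h
  calc (∫⁻ x, f x ∂μ) ^ 2 ≤ ((∫⁻ x, f x ^ 2 ∂μ) ^ (1 / 2 : ℝ)) ^ 2 := by gcongr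
    _ = ∫⁻ x, f x ^ 2 ∂μ := by
        rw [← ENNReal.rpow_natCast, ← ENNReal.rpow_mul]; norm_num
    _ ≤ K * ∫⁻ x, f x ^ 2 ∂μ := le_mul_of_one_le_left' hK

theorem map {K : ℝ≥0∞} {μ ν : Measure α} (h : Dominated K μ ν) {g : α → β} (hg : Measurable g) :
    Dominated K (μ.map g) (ν.map g) := by
  intro f hf hf1
  rw [lintegral_map hf hg, lintegral_map (hf.pow_const 2) hg]
  exact h _ (hf.comp hg) fun x => hf1 _

/-- Adaptive composition. The conditional expectation of `f` given `a` is again `[0,1]`-valued, so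
`h` applies to it; its square, now under `ν`, is bounded pointwise by `hstep`. -/
theorem map_prod {K₁ K₂ : ℝ≥0∞} {μ ν : Measure α} [SFinite μ] [SFinite ν] {ρ : Measure β}
    [IsProbabilityMeasure ρ] {Φ Ψ : α × β → γ} (hΦ : Measurable Φ) (hΨ : Measurable Ψ)
    (h : Dominated K₁ μ ν)
    (hstep : ∀ a, Dominated K₂ (ρ.map fun b => Φ (a, b)) (ρ.map fun b => Ψ (a, b))) :
    Dominated (K₁ * K₂) ((μ.prod ρ).map Φ) ((ν.prod ρ).map Ψ) := by
  intro f hf hf1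
  have hfΦ := hf.comp hΦ
  have hfΨ := (hf.pow_const 2).comp hΨ
  rw [lintegral_map hf hΦ, lintegral_map (hf.pow_const 2) hΨ]
  simp only [Function.comp_def] at hfΦ hfΨ
  rw [lintegral_prod _ hfΦ.aemeasurable, lintegral_prod _ hfΨ.aemeasurable]
  have hg : ∀ a, ∫⁻ b, f (Φ (a, b)) ∂ρ ≤ 1 := fun a =>
    (lintegral_mono fun b => hf1 _).trans (by simp)
  refine (h _ hfΦ.lintegral_prod_right' hg).trans ?_
  rw [mul_assoc, ← lintegral_const_mul _ hfΨ.lintegral_prod_right']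
  gcongr with a
  have := hstep a f hf hf1
  rwa [lintegral_map hf (by fun_prop), lintegral_map (hf.pow_const 2) (by fun_prop)] at this

theorem prod_right {K : ℝ≥0∞} {μ ν : Measure α} [SFinite μ] [SFinite ν] (h : Dominated K μ ν)
    (ρ : Measure β) [IsProbabilityMeasure ρ] : Dominated K (μ.prod ρ) (ν.prod ρ) := by
  have := map_prod (ρ := ρ) measurable_id measurable_id h (K₂ := 1) fun a => by
    have := Measure.isProbabilityMeasure_map (μ := ρ) (f := fun b => (a, b))
      measurable_prodMk_left.aemeasurable
    simp only [id_eq]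
    exact refl le_rfl _
  simpa only [Measure.map_id, mul_one] using this

/-- The coordinates other than `i₀` form a common independent factor, which costs nothing. -/
theorem pi_of_eq_of_ne {n : ℕ} {K : ℝ≥0∞} {μ ν : Fin n → Measure α}
    [∀ i, IsProbabilityMeasure (μ i)] [∀ i, IsProbabilityMeasure (ν i)] (i₀ : Fin n)
    (hne : ∀ i, i ≠ i₀ → μ i = ν i) (h : Dominated K (μ i₀) (ν i₀)) :
    Dominated K (Measure.pi μ) (Measure.pi ν) := by
  cases n with
  | zero => exact i₀.elim0
  | succ n =>
    rw [← ((measurePreserving_piFinSuccAbove μ i₀).symm).map_eq,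
      ← ((measurePreserving_piFinSuccAbove ν i₀).symm).map_eq]
    have : (fun j => μ (i₀.succAbove j)) = fun j => ν (i₀.succAbove j) :=
      funext fun j => hne _ (Fin.succAbove_ne _ _)
    rw [this]
    exact (h.prod_right _).map (MeasurableEquiv.measurable _)

end Dominated

theorem lintegral_uniformOn_fin {q : ℕ} [NeZero q] (f : Fin q → ℝ≥0∞) :
    ∫⁻ j, f j ∂(uniformOn (Set.univ : Set (Fin q))) = (∑ j, f j) / q := by
  rw [lintegral_fintype, ENNReal.div_eq_inv_mul, Finset.mul_sum]
  refine Finset.sum_congr rfl fun j _ => ?_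
  rw [uniformOn_univ, Measure.count_singleton, Fintype.card_fin, mul_comm, one_div]

theorem dominated_gaussian_mixture {d : ℕ} {v : ℝ≥0} (hv : v ≠ 0) {q : ℕ} [NeZero q]
    {a a' : Fin q → Fin d → ℝ} (j₀ : Fin q) (haa : ∀ j, j ≠ j₀ → a j = a' j) {M : ℝ}
    (ha : ∀ j, ∑ l, (a j₀ l - a' j l) ^ 2 ≤ M * v)
    (ha' : ∀ j, ∑ l, (a' j₀ l - a' j l) ^ 2 ≤ M * v) :
    Dominated (ENNReal.ofReal (1 + 4 * (Real.exp M - 1) / q ^ 2))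
      (((uniformOn (Set.univ : Set (Fin q))).prod
        (Measure.pi fun _ : Fin d => gaussianReal 0 v)).map fun r => a r.1 + r.2)
      (((uniformOn (Set.univ : Set (Fin q))).prod
        (Measure.pi fun _ : Fin d => gaussianReal 0 v)).map fun r => a' r.1 + r.2) := by
  have hq : (0 : ℝ) < q := by exact_mod_cast Nat.pos_of_neZero q
  have hmeas : ∀ c : Fin q → Fin d → ℝ,
      Measurable fun r : Fin q × (Fin d → ℝ) => c r.1 + r.2 := fun c =>
    ((measurable_of_finite c).comp measurable_fst).add measurable_snd
  have key : ∀ (c : Fin q → Fin d → ℝ) (f : (Fin d → ℝ) → ℝ≥0∞), Measurable f → (∀ x, f x ≤ 1) →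
      ∫⁻ x, f x ∂(((uniformOn (Set.univ : Set (Fin q))).prod
        (Measure.pi fun _ : Fin d => gaussianReal 0 v)).map fun r => c r.1 + r.2) =
      ENNReal.ofReal ((∑ j, ∫ θ, (f (c j + θ)).toReal
        ∂(Measure.pi fun _ : Fin d => gaussianReal 0 v)) / q) := fun c f hf hf1 => by
    have hfc := hf.comp (hmeas c)
    simp only [Function.comp_def] at hfc
    rw [lintegral_map hf (hmeas c), lintegral_prod _ hfc.aemeasurable,
      lintegral_uniformOn_fin, ENNReal.ofReal_div_of_pos hq, ENNReal.ofReal_natCast,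
      ENNReal.ofReal_sum_of_nonneg fun j _ => integral_nonneg fun _ => ENNReal.toReal_nonneg]
    congr 1
    refine Finset.sum_congr rfl fun j _ => ?_
    rw [ofReal_integral_eq_lintegral_ofReal]
    · refine lintegral_congr fun θ => ?_
      rw [ENNReal.ofReal_toReal (ne_top_of_le_ne_top ENNReal.one_ne_top (hf1 _))]
    · refine integrable_of_bounded (by fun_prop) (B := 1) fun θ => ?_
      rw [abs_of_nonneg ENNReal.toReal_nonneg]
      exact ENNReal.toReal_le_of_le_ofReal zero_le_one (by simpa using hf1 _)
    · exact Filter.Eventually.of_forall fun θ => ENNReal.toReal_nonneg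
  intro f hf hf1
  rw [key a f hf hf1, key a' _ (hf.pow_const 2) fun x => pow_le_one₀ zero_le (hf1 x),
    ← ENNReal.ofReal_pow, ← ENNReal.ofReal_mul']
  · refine ENNReal.ofReal_le_ofReal ?_
    simp only [ENNReal.toReal_pow]
    exact sq_integral_gaussian_mixture_le hv j₀ haa ha ha' (ψ := fun x => (f x).toReal)
      (by fun_prop) fun x => by
        rw [abs_of_nonneg ENNReal.toReal_nonneg]
        exact ENNReal.toReal_le_of_le_ofReal zero_le_one (by simpa using hf1 _)
  · exact div_nonneg (Finset.sum_nonneg fun j _ => integral_nonneg fun _ =>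
      ENNReal.toReal_nonneg) hq.le
  · exact div_nonneg (Finset.sum_nonneg fun j _ => integral_nonneg fun _ =>
      ENNReal.toReal_nonneg) hq.le


/-! ### Measurability of the sparsifier, the states and the gradients -/

theorem measurable_kept {d : ℕ} (k : ℕ) (j : Fin d) :
    MeasurableSet {x : EuclideanSpace ℝ (Fin d) | Kept k x j} := by
  have h : Measurable fun x : EuclideanSpace ℝ (Fin d) =>
      {l : Fin d | |x j| < |x l| ∨ (|x l| = |x j| ∧ l < j)} := by
    rw [measurable_set_iff]
    intro l
    have hc : ∀ i : Fin d, Measurable fun x : EuclideanSpace ℝ (Fin d) => |x i| := fun i => by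
      fun_prop
    refine Measurable.or ?_ (Measurable.and ?_ measurable_const)
    · exact measurableSet_setOfPred.mp (measurableSet_lt (hc j) (hc l))
    · exact measurableSet_setOfPred.mp (measurableSet_eq_fun (hc l) (hc j))
  -- The set of coordinates ranking before `j` takes finitely many values, so any condition on it is
  -- measurable.
  exact h (Set.toFinite {s : Set (Fin d) | s.ncard < k}).measurableSet

@[fun_prop]
theorem measurable_topK {d : ℕ} (k : ℕ) :
    Measurable (topK k : EuclideanSpace ℝ (Fin d) → EuclideanSpace ℝ (Fin d)) := by
  classical
  unfold topK
  refine (WithLp.measurable_toLp 2 (Fin d → ℝ)).comp (measurable_pi_iff.mpr fun j => ?_)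
  exact Measurable.ite (measurable_kept k j) (by fun_prop) measurable_const

instance {n d : ℕ} : MeasurableSpace (State n d) :=
  MeasurableSpace.comap (fun S => (S.x, S.xhat, S.m)) inferInstance

theorem measurable_state_iff {α : Type*} [MeasurableSpace α] {n d : ℕ} {f : α → State n d} :
    Measurable f ↔ Measurable (fun a => (f a).x) ∧ Measurable (fun a => (f a).xhat) ∧
      Measurable (fun a => (f a).m) := by
  rw [measurable_comap_iff]
  exact ⟨fun h => ⟨h.fst, h.snd.fst, h.snd.snd⟩, fun h => h.1.prodMk (h.2.1.prodMk h.2.2)⟩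

@[fun_prop]
theorem measurable_state_x {n d : ℕ} : Measurable (State.x : State n d → _) :=
  (measurable_state_iff.mp measurable_id).1

@[fun_prop]
theorem measurable_state_xhat {n d : ℕ} : Measurable (State.xhat : State n d → _) :=
  (measurable_state_iff.mp measurable_id).2.1

@[fun_prop]
theorem measurable_state_m {n d : ℕ} : Measurable (State.m : State n d → _) :=
  (measurable_state_iff.mp measurable_id).2.2

/-- The derivative of an arbitrary function is measurable, so losses need not be continuously
differentiable. -/
theorem measurable_gradient {E : Type*} [NormedAddCommGroup E] [InnerProductSpace ℝ E]
    [FiniteDimensional ℝ E] [MeasurableSpace E] [BorelSpace E] (f : E → ℝ) :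
    Measurable (gradient f) := by
  have := FiniteDimensional.complete ℝ E
  exact ((InnerProductSpace.toDual ℝ E).symm.continuous.measurable).comp (measurable_fderiv ℝ f)

/-! ### Messages as post-processing of the noisy gradients -/

namespace Setup

variable {n d q : ℕ} {Z : Fin n → Type*}

/-- The noisy stochastic gradients of all agents, together with their activations. The states and
the messages are a function of these that does not depend on the data. -/
noncomputable def release (A : Setup n d Z) (D : Dataset q Z) (S : State n d) (r : Fin n → Draw d q)
    (i : Fin n) : Bool × EuclideanSpace ℝ (Fin d) :=
  ((r i).1, A.grad D S r i + WithLp.toLp 2 (r i).2.2)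

/-- The new momenta as a function of the noisy stochastic gradients. -/
noncomputable def releasedM (A : Setup n d Z) (S : State n d) (u : Fin n → Bool × EuclideanSpace ℝ (Fin d))
    (i : Fin n) : EuclideanSpace ℝ (Fin d) :=
  if (u i).1 = true then (u i).2 + A.β • S.m i else A.β • S.m i

/-- The new private states as a function of the noisy stochastic gradients. -/
noncomputable def releasedX (A : Setup n d Z) (S : State n d) (u : Fin n → Bool × EuclideanSpace ℝ (Fin d))
    (i : Fin n) : EuclideanSpace ℝ (Fin d) :=
  if (u i).1 = true then
    S.x i - A.α • A.releasedM S u i + A.γ • ∑ j, A.W i j • (S.xhat j - S.xhat i)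
  else S.x i + A.γ • ∑ j, A.W i j • (S.xhat j - S.xhat i)

/-- The messages as a function of the noisy stochastic gradients. -/
noncomputable def releasedMessage (A : Setup n d Z) (k : ℕ) (S : State n d)
    (u : Fin n → Bool × EuclideanSpace ℝ (Fin d)) (i : Fin n) :
    Bool × EuclideanSpace ℝ (Fin d) :=
  if (u i).1 = true then (true, topK k (A.releasedX S u i - S.xhat i)) else (false, 0)

/-- The new variables as a function of the noisy stochastic gradients. -/
noncomputable def releasedStep (A : Setup n d Z) (k : ℕ) (S : State n d)
    (u : Fin n → Bool × EuclideanSpace ℝ (Fin d)) : State n d where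
  x := A.releasedX S u
  xhat := fun i => S.xhat i + (A.releasedMessage k S u i).2
  m := A.releasedM S u

/-- The dataset enters only through `release`. The latter also contains noisy gradients of inactive
agents, which are then ignored. -/
theorem message_eq (A : Setup n d Z) (k : ℕ) (D : Dataset q Z) (S : State n d)
    (r : Fin n → Draw d q) : A.message k D S r = A.releasedMessage k S (A.release D S r) :=
  rfl

theorem step_eq (A : Setup n d Z) (k : ℕ) (D : Dataset q Z) (S : State n d)
    (r : Fin n → Draw d q) : A.step k D S r = A.releasedStep k S (A.release D S r) :=
  rfl

section Measurability

variable {α : Type*} [MeasurableSpace α] {S : α → State n d}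
  {u : α → Fin n → Bool × EuclideanSpace ℝ (Fin d)}

theorem measurableSet_active (hu : Measurable u) (i : Fin n) :
    MeasurableSet {a | (u a i).1 = true} :=
  measurableSet_eq_fun (f := fun a => (u a i).1) (by fun_prop) measurable_const

theorem measurable_releasedM (A : Setup n d Z) (hS : Measurable S) (hu : Measurable u) :
    Measurable fun a => A.releasedM (S a) (u a) := by
  refine measurable_pi_iff.mpr fun i => Measurable.ite (measurableSet_active hu i) ?_ ?_ <;> fun_prop

theorem measurable_releasedX (A : Setup n d Z) (hS : Measurable S) (hu : Measurable u) :
    Measurable fun a => A.releasedX (S a) (u a) := by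
  have := A.measurable_releasedM hS hu
  refine measurable_pi_iff.mpr fun i => Measurable.ite (measurableSet_active hu i) ?_ ?_ <;> fun_prop

theorem measurable_releasedMessage (A : Setup n d Z) (k : ℕ) (hS : Measurable S)
    (hu : Measurable u) : Measurable fun a => A.releasedMessage k (S a) (u a) := by
  have := A.measurable_releasedX hS hu
  refine measurable_pi_iff.mpr fun i => Measurable.ite (measurableSet_active hu i) ?_ ?_ <;> fun_prop

theorem measurable_releasedStep (A : Setup n d Z) (k : ℕ) (hS : Measurable S)
    (hu : Measurable u) : Measurable fun a => A.releasedStep k (S a) (u a) := by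
  have := A.measurable_releasedMessage k hS hu
  refine measurable_state_iff.mpr ⟨A.measurable_releasedX hS hu, ?_, A.measurable_releasedM hS hu⟩
  refine measurable_pi_iff.mpr fun i => ?_
  simp only [releasedStep]
  fun_prop

theorem measurable_release (A : Setup n d Z) (D : Dataset q Z) (hS : Measurable S)
    {r : α → Fin n → Draw d q} (hr : Measurable r) :
    Measurable fun a => A.release D (S a) (r a) := by
  refine measurable_pi_iff.mpr fun i => Measurable.prodMk (by fun_prop) (Measurable.add ?_ ?_)
  · have h : Measurable fun z : Fin q × EuclideanSpace ℝ (Fin d) =>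
        gradient (fun y => A.loss i y (D i z.1)) z.2 :=
      measurable_from_prod_countable_right fun j =>
        measurable_gradient fun y => A.loss i y (D i j)
    exact h.comp (f := fun a => ((r a i).2.1, (S a).x i)) (by fun_prop)
  · exact (WithLp.measurable_toLp 2 (Fin d → ℝ)).comp (by fun_prop)

end Measurability

/-! ### Unrolling the run one iteration at a time -/

/-- The variables and the messages after all iterations. -/
noncomputable def run (A : Setup n d Z) (k : ℕ) (D : Dataset q Z) {T : ℕ} (ω : Fin T → Fin n → Draw d q) :
    State n d × (Fin T → Fin n → Bool × EuclideanSpace ℝ (Fin d)) :=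
  (A.state k D ω T le_rfl, A.transcript k D ω)

/-- One more iteration, with the messages appended to the transcript. -/
noncomputable def extend (A : Setup n d Z) (k : ℕ) (T : ℕ)
    (z : (State n d × (Fin T → Fin n → Bool × EuclideanSpace ℝ (Fin d))) ×
      (Fin n → Bool × EuclideanSpace ℝ (Fin d))) :
    State n d × (Fin (T + 1) → Fin n → Bool × EuclideanSpace ℝ (Fin d)) :=
  (A.releasedStep k z.1.1 z.2,
    Fin.snoc (α := fun _ => Fin n → Bool × EuclideanSpace ℝ (Fin d)) z.1.2
      (A.releasedMessage k z.1.1 z.2))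

theorem measurable_extend (A : Setup n d Z) (k T : ℕ) : Measurable (A.extend k T) := by
  refine Measurable.prodMk (A.measurable_releasedStep k (by fun_prop) (by fun_prop)) ?_
  refine measurable_pi_iff.mpr fun t => ?_
  refine Fin.lastCases ?_ (fun t => ?_) t
  · simp only [Fin.snoc_last]
    exact A.measurable_releasedMessage k (by fun_prop) (by fun_prop)
  · simp only [Fin.snoc_castSucc]
    fun_prop

theorem state_succ_eq (A : Setup n d Z) (k : ℕ) (D : Dataset q Z) {T : ℕ}
    (ω : Fin (T + 1) → Fin n → Draw d q) (t : ℕ) (h : t ≤ T) (h' : t ≤ T + 1) :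
    A.state k D ω t h' = A.state k D (fun s => ω s.castSucc) t h := by
  induction t with
  | zero => rfl
  | succ t ih =>
    simp only [state]
    rw [ih (by omega)]
    rfl

theorem run_succ (A : Setup n d Z) (k : ℕ) (D : Dataset q Z) {T : ℕ}
    (ω : Fin (T + 1) → Fin n → Draw d q) :
    A.run k D ω = A.extend k T (A.run k D (fun s => ω s.castSucc),
      A.release D (A.run k D (fun s => ω s.castSucc)).1 (ω (Fin.last T))) := by
  refine Prod.ext ?_ ?_
  · simp only [run, extend, state, ← step_eq]
    rw [A.state_succ_eq k D ω T le_rfl]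
    rfl
  · funext t
    simp only [run, extend, ← message_eq]
    refine Fin.lastCases ?_ (fun t => ?_) t
    · rw [Fin.snoc_last]
      exact congrArg (fun S => A.message k D S (ω (Fin.last T))) (A.state_succ_eq k D ω T le_rfl _)
    · rw [Fin.snoc_castSucc]
      exact congrArg (fun S => A.message k D S (ω t.castSucc)) (A.state_succ_eq k D ω t t.2.le _)

theorem measurable_run (A : Setup n d Z) (k : ℕ) (D : Dataset q Z) (T : ℕ) :
    Measurable (A.run k D : (Fin T → Fin n → Draw d q) → _) := by
  induction T with
  | zero =>
    refine Measurable.prodMk measurable_const (measurable_pi_iff.mpr fun t => t.elim0)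
  | succ T ih =>
    have h : Measurable fun ω : Fin (T + 1) → Fin n → Draw d q =>
        A.run k D (fun s => ω s.castSucc) := ih.comp (by fun_prop)
    rw [funext fun ω : Fin (T + 1) → Fin n → Draw d q => A.run_succ k D ω]
    exact (A.measurable_extend k T).comp
      (h.prodMk (A.measurable_release D (S := fun ω : Fin (T + 1) → Fin n → Draw d q =>
        (A.run k D (fun s => ω s.castSucc)).1) (r := fun ω => ω (Fin.last T)) h.fst (by fun_prop)))

end Setup

theorem isProbabilityMeasure_drawLaw (d q : ℕ) [NeZero q] {p : ℝ} (hp : 0 ≤ p) (hp1 : p ≤ 1)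
    (σ : ℝ) : IsProbabilityMeasure (drawLaw d q p σ) := by
  have : IsProbabilityMeasure
      (ENNReal.ofReal p • Measure.dirac true + ENNReal.ofReal (1 - p) • Measure.dirac false) :=
    ⟨by simp [← ENNReal.ofReal_add hp (sub_nonneg.mpr hp1)]⟩
  unfold drawLaw
  infer_instance

/-- If each iteration, from every state, is dominated with constant `K`, then so is the run. -/
theorem Setup.dominated_run {n d q : ℕ} [NeZero q] {Z : Fin n → Type*} (A : Setup n d Z) (k : ℕ)
    (D D' : Dataset q Z) {p σ : ℝ} (hp : 0 ≤ p) (hp1 : p ≤ 1) {K : ℝ≥0∞}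
    (hstep : ∀ S, Dominated K ((Measure.pi fun _ : Fin n => drawLaw d q p σ).map (A.release D S))
      ((Measure.pi fun _ : Fin n => drawLaw d q p σ).map (A.release D' S))) (T : ℕ) :
    Dominated (K ^ T) ((noiseLaw n d q T p σ).map (A.run k D))
      ((noiseLaw n d q T p σ).map (A.run k D')) := by
  have := isProbabilityMeasure_drawLaw d q hp hp1 σ
  induction T with
  | zero =>
    have : IsProbabilityMeasure (noiseLaw n d q 0 p σ) := by unfold noiseLaw; infer_instance
    have := Measure.isProbabilityMeasure_map (μ := noiseLaw n d q 0 p σ)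
      (A.measurable_run k D 0).aemeasurable
    have h : (A.run k D : (Fin 0 → _) → _) = A.run k D' := funext fun ω =>
      Prod.ext rfl (funext fun t => t.elim0)
    rw [← h]
    exact Dominated.refl (by simp) _
  | succ T ih =>
    set ρ := Measure.pi fun _ : Fin n => drawLaw d q p σ with hρ
    have : IsProbabilityMeasure (noiseLaw n d q T p σ) := by unfold noiseLaw; infer_instance
    -- The draws of the last iteration are independent of the earlier ones.
    have hmp : (noiseLaw n d q (T + 1) p σ).map
        (fun ω => ((fun s : Fin T => ω s.castSucc), ω (Fin.last T))) =
        (noiseLaw n d q T p σ).prod ρ := by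
      have h1 := (measurePreserving_piFinSuccAbove (fun _ : Fin (T + 1) => ρ) (Fin.last T)).map_eq
      have h2 := congrArg (Measure.map Prod.swap) h1
      rw [Measure.prod_swap, Measure.map_map measurable_swap (MeasurableEquiv.measurable _)] at h2
      rw [noiseLaw, noiseLaw, ← hρ, ← h2]
      congr 1
      funext ω
      simp [MeasurableEquiv.piFinSuccAbove, Fin.insertNthEquiv]
      rfl
    have hsplit : ∀ D : Dataset q Z,
        Measurable (fun z : (State n d × (Fin T → Fin n → Bool × EuclideanSpace ℝ (Fin d))) ×
          (Fin n → Draw d q) => A.extend k T (z.1, A.release D z.1.1 z.2)) := fun D =>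
      (A.measurable_extend k T).comp (measurable_fst.prodMk
        (A.measurable_release D (by fun_prop) (by fun_prop)))
    have hrun : ∀ D : Dataset q Z, (noiseLaw n d q (T + 1) p σ).map (A.run k D) =
        (((noiseLaw n d q T p σ).map (A.run k D)).prod ρ).map
          (fun z => A.extend k T (z.1, A.release D z.1.1 z.2)) := fun D => by
      have h1 : ((noiseLaw n d q T p σ).map (A.run k D)).prod ρ =
          ((noiseLaw n d q T p σ).prod ρ).map (Prod.map (A.run k D) id) := by
        rw [← Measure.map_prod_map _ _ (A.measurable_run k D T) measurable_id, Measure.map_id]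
      rw [h1, ← hmp, Measure.map_map ((A.measurable_run k D T).prodMap measurable_id)
        (by fun_prop), Measure.map_map (hsplit D)
        (((A.measurable_run k D T).prodMap measurable_id).comp (by fun_prop))]
      congr 1
      funext ω
      exact A.run_succ k D ω
    rw [hrun D, hrun D', pow_succ]
    -- The private state is part of `z`, so conditionally on `z` the new iteration is a fixed map
    -- applied to `release`.
    refine Dominated.map_prod (hsplit D) (hsplit D') ih fun z => ?_
    have hrel : ∀ D : Dataset q Z, Measurable (A.release D z.1) := fun D =>
      A.measurable_release D (α := Fin n → Draw d q) measurable_const measurable_id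
    have hext : Measurable fun u => A.extend k T (z, u) :=
      (A.measurable_extend k T).comp measurable_prodMk_left
    have := (hstep z.1).map hext
    rwa [Measure.map_map hext (hrel D), Measure.map_map hext (hrel D')] at this


/-! ### From domination to differential privacy -/

/-- Indicators give `P² ≤ KQ`. If `Q ≥ 1/(4K)`, then `P ≤ 1` suffices; otherwise `P ≤ 1/2`, while `1
- 1/(4K) ≥ 3/4`. -/
theorem Dominated.measure_le_add {α : Type*} [MeasurableSpace α] {μ ν : Measure α}
    [IsProbabilityMeasure μ] [IsProbabilityMeasure ν] {K : ℝ} (hK : 1 ≤ K)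
    (h : Dominated (ENNReal.ofReal K) μ ν) {s : Set α} (hs : MeasurableSet s) :
    μ s ≤ ν s + ENNReal.ofReal (1 - 1 / (4 * K)) := by
  have h1 := h (s.indicator 1) (measurable_one.indicator hs) fun x =>
    Set.indicator_le (g := fun _ => 1) (fun _ _ => le_rfl) x
  have hsq : ∀ x, s.indicator (1 : α → ℝ≥0∞) x ^ 2 = s.indicator 1 x := fun x => by
    by_cases hx : x ∈ s <;> simp [hx]
  simp only [hsq, lintegral_indicator_one hs] at h1
  have h2 : (μ.real s) ^ 2 ≤ K * ν.real s := by
    have := ENNReal.toReal_mono (by finiteness) h1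
    rwa [ENNReal.toReal_pow, ENNReal.toReal_mul, ENNReal.toReal_ofReal (by linarith)] at this
  have h3 : 1 / (4 * K) ≤ 1 / 4 := by
    rw [div_le_div_iff₀ (by positivity) (by positivity)]; linarith
  have h4 : μ.real s ≤ ν.real s + (1 - 1 / (4 * K)) := by
    by_cases hQ : 1 / (4 * K) ≤ ν.real s
    · linarith [measureReal_le_one (μ := μ) (s := s)]
    · have h5 : K * ν.real s ≤ 1 / 4 := by
        rw [not_le, lt_div_iff₀ (by positivity)] at hQ
        linarith
      have h6 : μ.real s ≤ 1 / 2 := by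
        nlinarith [measureReal_nonneg (μ := μ) (s := s)]
      linarith [measureReal_nonneg (μ := ν) (s := s)]
  rw [← ofReal_measureReal (μ := μ), ← ofReal_measureReal (μ := ν),
    ← ENNReal.ofReal_add measureReal_nonneg (by linarith)]
  exact ENNReal.ofReal_le_ofReal h4

theorem dominated_drawLaw_map {d q : ℕ} [NeZero q] {p σ : ℝ} (hp : 0 ≤ p) (hp1 : p ≤ 1)
    {K : ℝ≥0∞} {a a' : Fin q → Fin d → ℝ}
    (h : Dominated K
      (((uniformOn (Set.univ : Set (Fin q))).prod
        (Measure.pi fun _ : Fin d => gaussianReal 0 (σ ^ 2).toNNReal)).map fun r => a r.1 + r.2)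
      (((uniformOn (Set.univ : Set (Fin q))).prod
        (Measure.pi fun _ : Fin d => gaussianReal 0 (σ ^ 2).toNNReal)).map
          fun r => a' r.1 + r.2)) :
    Dominated K
      ((drawLaw d q p σ).map fun r => (r.1, WithLp.toLp 2 (a r.2.1 + r.2.2)))
      ((drawLaw d q p σ).map fun r => (r.1, WithLp.toLp 2 (a' r.2.1 + r.2.2))) := by
  have : IsProbabilityMeasure
      (ENNReal.ofReal p • Measure.dirac true + ENNReal.ofReal (1 - p) • Measure.dirac false) :=
    ⟨by simp [← ENNReal.ofReal_add hp (sub_nonneg.mpr hp1)]⟩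
  have hmeas : ∀ c : Fin q → Fin d → ℝ,
      Measurable fun r : Fin q × (Fin d → ℝ) => c r.1 + r.2 := fun c =>
    ((measurable_of_finite c).comp measurable_fst).add measurable_snd
  have hmeas' : ∀ c : Fin q → Fin d → ℝ,
      Measurable fun r : Draw d q => (r.1, WithLp.toLp 2 (c r.2.1 + r.2.2)) := fun c =>
    measurable_fst.prodMk ((WithLp.measurable_toLp 2 (Fin d → ℝ)).comp
      ((hmeas c).comp measurable_snd))
  rw [← one_mul K]
  -- The activation has the same law on both sides, so it contributes the factor `1`.
  refine Dominated.map_prod (hmeas' a) (hmeas' a') (Dominated.refl le_rfl _) fun b => ?_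
  have hb : Measurable fun x : Fin d → ℝ => (b, WithLp.toLp 2 x) :=
    measurable_const.prodMk (WithLp.measurable_toLp 2 (Fin d → ℝ))
  have := h.map hb
  rwa [Measure.map_map hb (hmeas a), Measure.map_map hb (hmeas a')] at this

theorem exp_sub_one_le_mul_exp (x : ℝ) : Real.exp x - 1 ≤ x * Real.exp x := by
  have h := Real.add_one_le_exp (-x)
  have h2 : Real.exp (-x) * Real.exp x = 1 := by rw [← Real.exp_add]; simp
  nlinarith [Real.exp_pos x]

namespace Setup

variable {n d q : ℕ} {Z : Fin n → Type*}

theorem dominated_release_of_agent [NeZero q] (A : Setup n d Z) {D D' : Dataset q Z} {i₀ : Fin n}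
    (hD : ∀ i, i ≠ i₀ → D i = D' i) {p σ : ℝ} (hp : 0 ≤ p) (hp1 : p ≤ 1) (S : State n d)
    {K : ℝ≥0∞}
    (h : Dominated K
      (((uniformOn (Set.univ : Set (Fin q))).prod
        (Measure.pi fun _ : Fin d => gaussianReal 0 (σ ^ 2).toNNReal)).map
          fun r => (gradient (fun y => A.loss i₀ y (D i₀ r.1)) (S.x i₀)).ofLp + r.2)
      (((uniformOn (Set.univ : Set (Fin q))).prod
        (Measure.pi fun _ : Fin d => gaussianReal 0 (σ ^ 2).toNNReal)).map
          fun r => (gradient (fun y => A.loss i₀ y (D' i₀ r.1)) (S.x i₀)).ofLp + r.2)) :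
    Dominated K ((Measure.pi fun _ : Fin n => drawLaw d q p σ).map (A.release D S))
      ((Measure.pi fun _ : Fin n => drawLaw d q p σ).map (A.release D' S)) := by
  have := isProbabilityMeasure_drawLaw d q hp hp1 σ
  set g : Dataset q Z → Fin n → Draw d q → Bool × EuclideanSpace ℝ (Fin d) := fun D i r =>
    (r.1, WithLp.toLp 2 ((gradient (fun y => A.loss i y (D i r.2.1)) (S.x i)).ofLp + r.2.2)) with hg
  have hgm : ∀ D i, Measurable (g D i) := fun D i => by
    have hm : Measurable fun r : Fin q × (Fin d → ℝ) =>
        (gradient (fun y => A.loss i y (D i r.1)) (S.x i)).ofLp + r.2 :=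
      ((measurable_of_finite fun j =>
        (gradient (fun y => A.loss i y (D i j)) (S.x i)).ofLp).comp measurable_fst).add
          measurable_snd
    exact measurable_fst.prodMk ((WithLp.measurable_toLp 2 (Fin d → ℝ)).comp
      (hm.comp measurable_snd))
  have hrel : ∀ D : Dataset q Z,
      (Measure.pi fun _ : Fin n => drawLaw d q p σ).map (A.release D S) =
        Measure.pi fun i => (drawLaw d q p σ).map (g D i) := fun D =>
    Measure.pi_map_pi (μ := fun _ : Fin n => drawLaw d q p σ) (f := g D)
      fun i => (hgm D i).aemeasurable
  have hprob : ∀ D i, IsProbabilityMeasure ((drawLaw d q p σ).map (g D i)) := fun D i =>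
    Measure.isProbabilityMeasure_map (hgm D i).aemeasurable
  rw [hrel D, hrel D']
  refine Dominated.pi_of_eq_of_ne i₀ (fun i hi => ?_) ?_
  · simp only [hg, hD i hi]
  · exact dominated_drawLaw_map (a := fun j => (gradient (fun y => A.loss i₀ y (D i₀ j)) (S.x i₀)).ofLp)
      (a' := fun j => (gradient (fun y => A.loss i₀ y (D' i₀ j)) (S.x i₀)).ofLp) hp hp1 h

/-- One iteration on neighbouring datasets. -/
theorem dominated_release [NeZero q] (A : Setup n d Z) {D D' : Dataset q Z}
    (hDD : Neighboring D D') {G : ℝ} (hA : A.BoundedGradients G) (hd : 0 < d) {p σ : ℝ}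
    (hp : 0 ≤ p) (hp1 : p ≤ 1) (hσ : σ = 0 → G = 0) (S : State n d) :
    Dominated (ENNReal.ofReal (1 + 4 * (Real.exp (4 * G ^ 2 / σ ^ 2) - 1) / q ^ 2))
      ((Measure.pi fun _ : Fin n => drawLaw d q p σ).map (A.release D S))
      ((Measure.pi fun _ : Fin n => drawLaw d q p σ).map (A.release D' S)) := by
  obtain ⟨i₀, j₀, hij⟩ := hDD
  refine A.dominated_release_of_agent (i₀ := i₀)
    (fun i hi => funext fun j => hij i j fun h => hi h.1) hp hp1 S ?_
  have hd' : (0 : ℝ) < d := by exact_mod_cast hd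
  have hgj : ∀ j, j ≠ j₀ → (gradient (fun y => A.loss i₀ y (D i₀ j)) (S.x i₀)).ofLp =
      (gradient (fun y => A.loss i₀ y (D' i₀ j)) (S.x i₀)).ofLp := fun j hj => by
    rw [hij i₀ j fun h => hj h.2]
  have hdiff : ∀ ζ ζ' : Z i₀, ∑ l, (gradient (fun y => A.loss i₀ y ζ) (S.x i₀) l -
      gradient (fun y => A.loss i₀ y ζ') (S.x i₀) l) ^ 2 ≤ 4 * G ^ 2 := fun ζ ζ' => by
    calc _ ≤ ∑ _l : Fin d, 4 * G ^ 2 / d := Finset.sum_le_sum fun l _ => by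
          have h1 := (hA i₀ ζ).2 (S.x i₀) l
          have h2 := (hA i₀ ζ').2 (S.x i₀) l
          have h3 := (abs_sub _ _).trans (add_le_add h1 h2)
          have h4 := pow_le_pow_left₀ (abs_nonneg _) h3 2
          rw [sq_abs] at h4
          refine h4.trans_eq ?_
          rw [← two_mul, mul_pow, div_pow, Real.sq_sqrt hd'.le]
          ring
      _ = 4 * G ^ 2 := by
          rw [Finset.sum_const, Finset.card_univ, Fintype.card_fin, nsmul_eq_mul,
            mul_div_cancel₀ _ hd'.ne']
  -- Without noise `G = 0`, so all gradients agree and the two laws coincide.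
  by_cases hσ0 : σ = 0
  · have hG := hσ hσ0
    have hgrad : ∀ ζ ζ' : Z i₀, gradient (fun y => A.loss i₀ y ζ) (S.x i₀) =
        gradient (fun y => A.loss i₀ y ζ') (S.x i₀) := fun ζ ζ' => by
      ext l
      have h := hdiff ζ ζ'
      rw [hG] at h
      have h2 := (Finset.single_le_sum (f := fun l => (gradient (fun y => A.loss i₀ y ζ) (S.x i₀) l -
        gradient (fun y => A.loss i₀ y ζ') (S.x i₀) l) ^ 2) (fun _ _ => sq_nonneg _)
        (Finset.mem_univ l)).trans h
      rw [zero_pow two_ne_zero, mul_zero] at h2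
      exact sub_eq_zero.mp (pow_eq_zero_iff two_ne_zero |>.mp (le_antisymm h2 (sq_nonneg _)))
    have hm : Measurable fun r : Fin q × (Fin d → ℝ) =>
        (gradient (fun y => A.loss i₀ y (D' i₀ r.1)) (S.x i₀)).ofLp + r.2 :=
      ((measurable_of_finite fun j =>
        (gradient (fun y => A.loss i₀ y (D' i₀ j)) (S.x i₀)).ofLp).comp measurable_fst).add
          measurable_snd
    simp only [fun j => hgrad (D i₀ j) (D' i₀ j)]
    have := Measure.isProbabilityMeasure_map
      (μ := (uniformOn (Set.univ : Set (Fin q))).prod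
        (Measure.pi fun _ : Fin d => gaussianReal 0 (σ ^ 2).toNNReal)) hm.aemeasurable
    refine Dominated.refl ?_ _
    simp [hG]
  · have hσ2 : 0 < σ ^ 2 := by positivity
    have hM : 4 * G ^ 2 / σ ^ 2 * ((σ ^ 2).toNNReal : ℝ) = 4 * G ^ 2 := by
      rw [Real.coe_toNNReal _ hσ2.le, div_mul_cancel₀ _ hσ2.ne']
    refine dominated_gaussian_mixture (Real.toNNReal_pos.mpr hσ2).ne' j₀ hgj ?_ ?_ <;>
    · intro j
      rw [hM]
      exact hdiff _ _

theorem isDP_of_exp_le (A : Setup n d Z) (k : ℕ) {T : ℕ} (hq : 1 ≤ q) (hd : 0 < d) {G : ℝ}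
    (hA : A.BoundedGradients G) {p σ ε C : ℝ} (hp : 0 ≤ p) (hp1 : p ≤ 1) (hε : 0 ≤ ε) (hC : 0 ≤ C)
    (hσ : σ = 0 → G = 0)
    (hGC : T * (4 * (Real.exp (4 * G ^ 2 / σ ^ 2) - 1) / q ^ 2) ≤ C) :
    A.IsDP k q T p σ ε (1 - 1 / (4 * Real.exp C)) := by
  have : NeZero q := ⟨by omega⟩
  intro D D' hDD O hO
  have := isProbabilityMeasure_drawLaw d q hp hp1 σ
  have : IsProbabilityMeasure (noiseLaw n d q T p σ) := by unfold noiseLaw; infer_instance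
  have htr : ∀ D : Dataset q Z,
      Measurable (A.transcript k D : (Fin T → Fin n → Draw d q) → _) := fun D =>
    (A.measurable_run k D T).snd
  have hprob : ∀ D : Dataset q Z,
      IsProbabilityMeasure ((noiseLaw n d q T p σ).map (A.transcript k D)) := fun D =>
    Measure.isProbabilityMeasure_map (htr D).aemeasurable
  have hdom := (A.dominated_run k D D' hp hp1 (A.dominated_release hDD hA hd hp hp1 hσ) T).map
    measurable_snd
  rw [Measure.map_map measurable_snd (A.measurable_run k D T),
    Measure.map_map measurable_snd (A.measurable_run k D' T)] at hdom
  have hs : 0 ≤ 4 * (Real.exp (4 * G ^ 2 / σ ^ 2) - 1) / (q : ℝ) ^ 2 := by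
    have := Real.one_le_exp (x := 4 * G ^ 2 / σ ^ 2) (by positivity)
    have : 0 ≤ Real.exp (4 * G ^ 2 / σ ^ 2) - 1 := by linarith
    positivity
  have hK : ENNReal.ofReal (1 + 4 * (Real.exp (4 * G ^ 2 / σ ^ 2) - 1) / q ^ 2) ^ T ≤
      ENNReal.ofReal (Real.exp C) := by
    rw [← ENNReal.ofReal_pow (by linarith)]
    refine ENNReal.ofReal_le_ofReal ?_
    calc _ ≤ Real.exp (4 * (Real.exp (4 * G ^ 2 / σ ^ 2) - 1) / q ^ 2) ^ T := by
          gcongr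
          linarith [Real.add_one_le_exp (4 * (Real.exp (4 * G ^ 2 / σ ^ 2) - 1) / (q : ℝ) ^ 2)]
      _ = Real.exp (T * (4 * (Real.exp (4 * G ^ 2 / σ ^ 2) - 1) / q ^ 2)) :=
          (Real.exp_nat_mul _ _).symm
      _ ≤ Real.exp C := Real.exp_le_exp.mpr hGC
  have hdom' : Dominated (ENNReal.ofReal (Real.exp C))
      ((noiseLaw n d q T p σ).map (A.transcript k D))
      ((noiseLaw n d q T p σ).map (A.transcript k D')) := fun f hf hf1 =>
    (hdom f hf hf1).trans (by gcongr; exact le_rfl)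
  have h := hdom'.measure_le_add (Real.one_le_exp hC) hO
  rw [Measure.map_apply (htr D) hO, Measure.map_apply (htr D') hO] at h
  refine h.trans ?_
  gcongr
  refine le_mul_of_one_le_left' ?_
  rw [ENNReal.one_le_ofReal]
  exact Real.one_le_exp hε

end Setup

end DOADP

/-! ### Choice of the constants -/

theorem theorem1 (d k : ℕ) (hk : 1 ≤ k) (hkd : k ≤ d)
    (p : ℝ) (hp : 1 / 2 ≤ p) (hp1 : p ≤ 1)
    (ε : ℝ) (hε : 0 < ε) (hε1 : ε ≤ 1)
    (δ₀ : ℝ) (hδ₀ : 0 < δ₀) (hδ₀1 : δ₀ ≤ 1) :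
    ∃ δ : ℝ, 0 < δ ∧ δ < 1 ∧
      ∀ (n q T : ℕ) (Z : Fin n → Type*) (A : DOADP.Setup n d Z) (G σ : ℝ),
        1 ≤ q →
        A.BoundedGradients G →
        160 * k * p ^ 2 * T * Real.log (1.25 / δ₀) * G ^ 2 / ((q : ℝ) ^ 2 * d * ε ^ 2) ≤ σ ^ 2 →
        (q : ℝ) ^ 2 * ε ^ 2 / (4 * p ^ 2) ≤ T →
        A.IsDP k q T p σ ε δ := by
  have hd : 0 < d := by omega
  have hd' : (0 : ℝ) < d := by exact_mod_cast hd
  have hk' : (0 : ℝ) < k := by exact_mod_cast hk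
  have hp0 : 0 < p := by linarith
  have hL : 0 < Real.log (1.25 / δ₀) := Real.log_pos (by rw [lt_div_iff₀ hδ₀]; linarith)
  set L := Real.log (1.25 / δ₀) with hLdef
  -- `κ` is chosen so that the noise condition reads `4 G² T ≤ κ q² σ²`, that is, `T M ≤ κ q²` when
  -- `σ ≠ 0`.
  set κ : ℝ := d * ε ^ 2 / (40 * k * p ^ 2 * L) with hκ
  have hκ0 : 0 < κ := by positivity
  -- From `exp M - 1 ≤ M exp M`, `T M ≤ κ q²` and `M ≤ 4p²κ/ε²`.
  set C : ℝ := 4 * κ * Real.exp (4 * p ^ 2 * κ / ε ^ 2) with hC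
  have hC0 : 0 < C := by positivity
  refine ⟨1 - 1 / (4 * Real.exp C), ?_, ?_, ?_⟩
  · have : 1 / (4 * Real.exp C) < 1 := by
      rw [div_lt_one (by positivity)]
      linarith [Real.one_le_exp hC0.le]
    linarith
  · have : 0 < 1 / (4 * Real.exp C) := by positivity
    linarith
  intro n q T Z A G σ hq hA hσ hT
  have hq' : (0 : ℝ) < q := by exact_mod_cast hq
  have hT0 : (0 : ℝ) < T := lt_of_lt_of_le (by positivity) hT
  have hσ' : 4 * G ^ 2 * T ≤ κ * q ^ 2 * σ ^ 2 := by
    rw [div_le_iff₀ (by positivity)] at hσ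
    rw [hκ, div_mul_eq_mul_div, div_mul_eq_mul_div, le_div_iff₀ (by positivity)]
    linarith
  refine A.isDP_of_exp_le k hq hd hA hp0.le hp1 hε.le hC0.le ?_ ?_
  · intro h0
    rw [h0] at hσ'
    have : G ^ 2 ≤ 0 := by
      by_contra! h
      have : 0 < 4 * G ^ 2 * T := by positivity
      linarith
    exact pow_eq_zero_iff two_ne_zero |>.mp (le_antisymm this (sq_nonneg _))
  · have hM : T * (4 * G ^ 2 / σ ^ 2) ≤ κ * q ^ 2 := by
      rw [← mul_div_assoc]
      exact div_le_of_le_mul₀ (sq_nonneg _) (by positivity) (by linarith)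
    -- The lower bound on `T` gives `q² ≤ 4p²T/ε²`, which removes `q` and `T` from `M ≤ κ q²/T`.
    have hM' : 4 * G ^ 2 / σ ^ 2 ≤ 4 * p ^ 2 * κ / ε ^ 2 := by
      rw [div_le_iff₀ (by positivity)] at hT
      rw [le_div_iff₀ (by positivity)]
      have h1 : T * (4 * G ^ 2 / σ ^ 2 * ε ^ 2) ≤ T * (4 * p ^ 2 * κ) := by
        calc T * (4 * G ^ 2 / σ ^ 2 * ε ^ 2) = T * (4 * G ^ 2 / σ ^ 2) * ε ^ 2 := by ring
          _ ≤ κ * q ^ 2 * ε ^ 2 := by gcongr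
          _ = κ * (q ^ 2 * ε ^ 2) := by ring
          _ ≤ κ * (T * (4 * p ^ 2)) := by gcongr
          _ = _ := by ring
      exact le_of_mul_le_mul_left h1 hT0
    have hM0 : 0 ≤ 4 * G ^ 2 / σ ^ 2 := by positivity
    generalize 4 * G ^ 2 / σ ^ 2 = M at hM hM' hM0
    rw [← mul_div_assoc, div_le_iff₀ (by positivity)]
    calc T * (4 * (Real.exp M - 1)) ≤ T * (4 * (M * Real.exp M)) := by
          gcongr; exact DOADP.exp_sub_one_le_mul_exp M
      _ = 4 * (T * M) * Real.exp M := by ring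
      _ ≤ 4 * (κ * q ^ 2) * Real.exp (4 * p ^ 2 * κ / ε ^ 2) := by gcongr
      _ = C * q ^ 2 := by rw [hC]; ring
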